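/- Let $\mathbf{k}$ be a commutative unital ring, $\lambda\in\mathbf{k}$, and $X$ a set. Algebras are unital, associative $\mathbf{k}$-algebras, not necessarily commutative. A Rota--Baxter algebra of weight $\lambda$ is an algebra $R$ with a linear operator $P:R\to R$ such that $P(a)P(b)=P\big(P(a)b+aP(b)+\lambda ab\big)$ for all $a,b\in R$. Let $\mathcal{T}(X)$ be the set of angularly $X$-decorated planar rooted trees (the case of a trivial semigroup $\Omega$, where the internal edges carry no information): an element $T$ is a planar rooted tree with at least one vertex, whose root vertex has $n+1\ge 1$ branches $T_1,\dots,T_{n+1}$ in order from left to right, where each $T_i$ is either a leaf $|$ or again an element of $\mathcal{T}(X)$, and whose $n$ angles between adjacent branches are decorated by $x_1,\dots,x_n\in X$. Write $T=[T_1,x_1,T_2,\dots,x_n,T_{n+1}]$, and put $\bullet=[\,|\,]$, $j_X(x)=[\,|,x,|\,]$ and $B^+(T)=[T]$. Let $\mathbf{k}\mathcal{T}(X)$ be the free $\mathbf{k}$-module on $\mathcal{T}(X)$, and extend $B^+$ linearly. The bilinear product $\diamond$ on $\mathbf{k}\mathcal{T}(X)$ is defined on trees $T=[T_1,x_1,\dots,x_m,T_{m+1}]$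 and $T'=[T'_1,y_1,\dots,y_n,T'_{n+1}]$ by induction on the sum of their depths: * if $T'_1=|$, then $T\diamond T'=[T_1,x_1,\dots,x_m,T_{m+1},y_1,T'_2,\dots,y_n,T'_{n+1}]$; * if $T_{m+1}=|$, then $T\diamond T'=[T_1,x_1,\dots,x_m,T'_1,y_1,T'_2,\dots,y_n,T'_{n+1}]$; * if $T_{m+1}\ne|$ and $T'_1\ne|$, then $T\diamond T'=\sum_U c_U\,[T_1,x_1,\dots,x_m,U,y_1,T'_2,\dots,y_n,T'_{n+1}]$, where $\sum_U c_U\,U=B^+(T_{m+1})\diamond T'_1+T_{m+1}\diamond B^+(T'_1)+\lambda\,T_{m+1}\diamond T'_1$ with $U\in\mathcal{T}(X)$. Then $(\mathbf{k}\mathcal{T}(X),\diamond,B^+)$ with unit $\bullet$ and the map $j_X:X\to\mathbf{k}\mathcal{T}(X)$ is the free Rota--Baxter algebra of weight $\lambda$ on $X$. That is, it is a Rota--Baxter algebra of weight $\lambda$, and for every Rota--Baxter algebra $(R,P)$ of weight $\lambda$ and every map $f:X\to R$ there is a unique unital algebra homomorphism $\varphi:\mathbf{k}\mathcal{T}(X)\to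 R$ with $\varphi\circ B^+=P\circ\varphi$ and $\varphi\circ j_X=f$. -/

import Mathlib

universe u v w z

/- Angularly `X`-decorated planar rooted trees.  The root and the leaves are edges, every vertex has
at least one incoming edge, and each angle between two adjacent incoming edges of a vertex carries
an element of `X`. -/

mutual

/-- A planar rooted tree with at least one vertex, given by the incoming edges of its lowest
vertex, read from left to right and separated by the decorations of the angles between them:
`cons b₁ x₁ (cons b₂ x₂ (… (cons bₙ xₙ (last bₙ₊₁))))` is the tree with branches
`b₁, …, bₙ₊₁` and angle decorations `x₁, …, xₙ`, where `n ≥ 0`. -/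
inductive AngTree (X : Type v) : Type v where
  | last (b : AngBranch X) : AngTree X
  | cons (b : AngBranch X) (x : X) (T : AngTree X) : AngTree X

/-- An incoming edge of a vertex with what sits on top of it: either it is a leaf, that is the
tree `|` without vertices, or it is an internal edge that carries a tree. -/
inductive AngBranch (X : Type v) : Type v where
  | leaf : AngBranch X
  | edge (T : AngTree X) : AngBranch X

end

mutual

/-- The maximal length of a chain from the root to a leaf. -/
def AngTree.depth {X : Type*} : AngTree X → ℕ
  | .last b => b.depth + 1
  | .cons b _ T => max (b.depth + 1) T.depth

/-- The depth of a branch; the tree `|` has depth `0`. -/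
def AngBranch.depth {X : Type*} : AngBranch X → ℕ
  | .leaf => 0
  | .edge T => T.depth

end

namespace AngTree

/-- The tree `•` with one vertex and one leaf. -/
def dot {X : Type*} : AngTree X := last .leaf

/-- The tree with one vertex, two leaves, and one angle, which is decorated by `x`. -/
def corolla {X : Type*} (x : X) : AngTree X := cons .leaf x (last .leaf)

/-- The grafting `B⁺(T)`: a new root vertex whose only incoming edge carries `T`. -/
def graft {X : Type*} (T : AngTree X) : AngTree X := last (.edge T)

/-- The leftmost branch `T₁` of `T`. -/
def firstBranch {X : Type*} : AngTree X → AngBranch X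
  | last b => b
  | cons b _ _ => b

/-- The rightmost branch `Tₙ₊₁` of `T`. -/
def lastBranch {X : Type*} : AngTree X → AngBranch X
  | last b => b
  | cons _ _ T => T.lastBranch

/-- Replace the leftmost branch of a tree by `b`. -/
def setFirst {X : Type*} (b : AngBranch X) : AngTree X → AngTree X
  | last _ => last b
  | cons _ x T => cons b x T

/-- For `T` with branches `T₁, …, Tₘ₊₁` and angles `x₁, …, xₘ`, and `T'` with branches
`T'₁, …, T'ₙ₊₁` and angles `y₁, …, yₙ`, the tree with branches `T₁, …, Tₘ, b, T'₂, …, T'ₙ₊₁` and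
angles `x₁, …, xₘ, y₁, …, yₙ`. -/
def join {X : Type*} : AngTree X → AngBranch X → AngTree X → AngTree X
  | last _, b, T' => T'.setFirst b
  | cons c x T, b, T' => cons c x (join T b T')

theorem depth_firstBranch_lt {X : Type*} (T : AngTree X) : T.firstBranch.depth < T.depth := by
  cases T <;> simp [firstBranch, depth]

theorem depth_lastBranch_lt {X : Type*} : (T : AngTree X) → T.lastBranch.depth < T.depth
  | last b => by simp [lastBranch, depth]
  | cons b x T => by
      have h := depth_lastBranch_lt T
      simp only [lastBranch, depth]
      exact lt_max_of_lt_right h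

/-- The product `T ⋄ T'` of two trees, by induction on `T.depth + T'.depth`.  If the rightmost
branch of `T` or the leftmost branch of `T'` is a leaf, the lowest vertices of `T` and `T'` are
merged, and so are these two branches.  If they are internal edges that carry trees `S` and `S'`,
their place is taken by `B⁺(S) ⋄ B⁺(S') = B⁺(B⁺(S) ⋄ S' + S ⋄ B⁺(S') + lam • (S ⋄ S'))`. -/
noncomputable def diamond {X k : Type*} [CommRing k] (lam : k) (T T' : AngTree X) :
    AngTree X →₀ k :=
  match h : T.lastBranch, h' : T'.firstBranch with
  | .leaf, b => Finsupp.single (join T b T') 1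
  | .edge S, .leaf => Finsupp.single (join T (.edge S) T') 1
  | .edge S, .edge S' =>
      Finsupp.mapDomain (fun U => join T (.edge U) T')
        (diamond lam S.graft S' + diamond lam S S'.graft + lam • diamond lam S S')
termination_by T.depth + T'.depth
decreasing_by
  all_goals
    have h1 := depth_lastBranch_lt T
    have h2 := depth_firstBranch_lt T'
    rw [h] at h1
    rw [h'] at h2
    simp only [graft, depth, AngBranch.depth] at h1 h2 ⊢
    omega

/- In the last case `B⁺(S) ⋄ B⁺(S')` is a sum of trees `B⁺(U)`; the product of `T`, with its
rightmost branch replaced by `|`, with `B⁺(U)` and then with `T'`, with its leftmost branch replaced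
by `|`, only merges lowest vertices and is the tree `join T (.edge U) T'`. -/

/-- The bilinear extension of `⋄` to the free module `k 𝒯(X)` on the set of trees. -/
noncomputable def mulHom {k : Type*} [CommRing k] (X : Type*) (lam : k) :
    (AngTree X →₀ k) →ₗ[k] (AngTree X →₀ k) →ₗ[k] (AngTree X →₀ k) :=
  Finsupp.linearCombination k fun T : AngTree X =>
    Finsupp.linearCombination k fun T' : AngTree X => diamond lam T T'

/-- The linear extension of the grafting operator `B⁺` to `k 𝒯(X)`. -/
noncomputable def graftHom (k : Type*) [CommRing k] (X : Type*) :
    (AngTree X →₀ k) →ₗ[k] (AngTree X →₀ k) :=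
  Finsupp.lmapDomain k k graft

/-- The map `j_X : X → k 𝒯(X)`, which sends `x` to the corolla decorated by `x`. -/
noncomputable def gen (k : Type*) [CommRing k] {X : Type*} (x : X) : AngTree X →₀ k :=
  Finsupp.single (corolla x) 1

/-- The unit `•` of `k 𝒯(X)`. -/
noncomputable def unit (k : Type*) [CommRing k] (X : Type*) : AngTree X →₀ k :=
  Finsupp.single dot 1

end AngTree

/-- `P` is a Rota–Baxter operator of weight `lam` for the bilinear product `mul`. -/
def IsRotaBaxterOperator {k A : Type*} [CommRing k] [AddCommGroup A] [Module k A]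
    (lam : k) (mul : A →ₗ[k] A →ₗ[k] A) (P : A →ₗ[k] A) : Prop :=
  ∀ a b : A, mul (P a) (P b) = P (mul (P a) b + mul a (P b) + lam • mul a b)

/-- The `k`-module `A` with the bilinear product `mul`, the element `one`, and the linear operator
`P` is a unital associative Rota–Baxter algebra of weight `lam`, and it is free on the set `X` with
respect to the map `j : X → A` (tested against Rota–Baxter algebras in the universe `w`). -/
structure IsFreeRotaBaxterAlgebra {k : Type u} {X : Type v} {A : Type z} [CommRing k]
    [AddCommGroup A] [Module k A] (lam : k) (mul : A →ₗ[k] A →ₗ[k] A) (one : A)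
    (P : A →ₗ[k] A) (j : X → A) : Prop where
  mul_assoc : ∀ a b c : A, mul (mul a b) c = mul a (mul b c)
  one_mul : ∀ a : A, mul one a = a
  mul_one : ∀ a : A, mul a one = a
  rotaBaxter : IsRotaBaxterOperator lam mul P
  existsUnique_hom : ∀ (R : Type w) [Ring R] [Algebra k R] (Q : R →ₗ[k] R),
    IsRotaBaxterOperator lam (LinearMap.mul k R) Q → ∀ f : X → R,
      ∃! φ : A →ₗ[k] R, φ one = 1 ∧ (∀ a b : A, φ (mul a b) = φ a * φ b) ∧
        (∀ a : A, φ (P a) = Q (φ a)) ∧ ∀ x : X, φ (j x) = f x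

/-!
The module `k 𝒯(X)` is generated from `•` by `B⁺` and by the operations `(a, b) ↦ a ⋄ j_X(x) ⋄ b`,
which only insert an angle between two trees and therefore commute with products from either side.
An identity of multilinear maps thus reduces to its case with `B⁺` in every argument. For
associativity, the Rota–Baxter identity writes the associator of `(B⁺ a, B⁺ b, B⁺ c)` as `B⁺` of a
combination of associators in which at least one `B⁺` is missing, so that it vanishes by induction.
The same induction shows that the evaluation of trees in a Rota–Baxter algebra is multiplicative,
and generation makes it the only such homomorphism.
-/

section MixedAssociator

variable {k A B C D E M : Type*} [CommRing k] [AddCommGroup A] [Module k A] [AddCommGroup B]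
  [Module k B] [AddCommGroup C] [Module k C] [AddCommGroup D] [Module k D] [AddCommGroup E]
  [Module k E] [AddCommGroup M] [Module k M]

/-- The trilinear map `(a, b, c) ↦ p (q a b) c - r a (s b c)`, which measures the failure of a mixed
associative law of four bilinear maps. -/
def mixedAssociator (p : D →ₗ[k] C →ₗ[k] M) (q : A →ₗ[k] B →ₗ[k] D) (r : A →ₗ[k] E →ₗ[k] M)
    (s : B →ₗ[k] C →ₗ[k] E) : A →ₗ[k] B →ₗ[k] C →ₗ[k] M :=
  q.compr₂ p - (LinearMap.llcomp k C E M ∘ₗ r).compl₂ s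

theorem mixedAssociator_apply (p : D →ₗ[k] C →ₗ[k] M) (q : A →ₗ[k] B →ₗ[k] D)
    (r : A →ₗ[k] E →ₗ[k] M) (s : B →ₗ[k] C →ₗ[k] E) (a : A) (b : B) (c : C) :
    mixedAssociator p q r s a b c = p (q a b) c - r a (s b c) :=
  rfl

theorem mixedAssociator_eq_zero_iff {p : D →ₗ[k] C →ₗ[k] M} {q : A →ₗ[k] B →ₗ[k] D}
    {r : A →ₗ[k] E →ₗ[k] M} {s : B →ₗ[k] C →ₗ[k] E} :
    mixedAssociator p q r s = 0 ↔ ∀ a b c, p (q a b) c = r a (s b c) := by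
  simp only [LinearMap.ext_iff, mixedAssociator_apply, LinearMap.zero_apply, sub_eq_zero]

/-- The associator `(a, b, c) ↦ (a * b) * c - a * (b * c)` of a bilinear product. -/
def mulAssociator (mul : A →ₗ[k] A →ₗ[k] A) : A →ₗ[k] A →ₗ[k] A →ₗ[k] A :=
  mixedAssociator mul mul mul mul

theorem mulAssociator_apply (mul : A →ₗ[k] A →ₗ[k] A) (a b c : A) :
    mulAssociator mul a b c = mul (mul a b) c - mul a (mul b c) :=
  rfl

theorem IsRotaBaxterOperator.mulAssociator_map {lam : k} {mul : A →ₗ[k] A →ₗ[k] A}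
    {P : A →ₗ[k] A} (hP : IsRotaBaxterOperator lam mul P) (a b c : A) :
    mulAssociator mul (P a) (P b) (P c) =
      P (mulAssociator mul (P a) (P b) c + mulAssociator mul (P a) b (P c) +
        mulAssociator mul a (P b) (P c) +
        lam • (mulAssociator mul (P a) b c + mulAssociator mul a (P b) c +
          mulAssociator mul a b (P c)) +
        lam ^ 2 • mulAssociator mul a b c) := by
  have h_left : mul (mul (P a) (P b)) (P c) =
      P (mul (mul (P a) (P b)) c + mul (mul (P a) b + mul a (P b) + lam • mul a b) (P c) +
        lam • mul (mul (P a) b + mul a (P b) + lam • mul a b) c) := by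
    rw [hP a b, hP _ c]
  have h_right : mul (P a) (mul (P b) (P c)) =
      P (mul (P a) (mul (P b) c + mul b (P c) + lam • mul b c) + mul a (mul (P b) (P c)) +
        lam • mul a (mul (P b) c + mul b (P c) + lam • mul b c)) := by
    rw [hP b c, hP a]
  rw [mulAssociator_apply, h_left, h_right, ← map_sub]
  congr 1
  simp only [mulAssociator_apply, map_add, map_smul, LinearMap.add_apply, LinearMap.smul_apply]
  module

end MixedAssociator

namespace AngTree

section Append

variable {X : Type*}

/-- The lowest vertices of `T` and `U` merged into one, with a new angle decorated by `x` between
the branches of `T` and those of `U`; in `k 𝒯(X)` this is `T ⋄ j_X(x) ⋄ U`. -/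
def append : AngTree X → X → AngTree X → AngTree X
  | last b, x, U => cons b x U
  | cons b y T, x, U => cons b y (append T x U)

@[elab_as_elim]
theorem dot_graft_append_induction {motive : AngTree X → Prop} (T : AngTree X)
    (dot : motive dot) (graft : ∀ T, motive T → motive T.graft)
    (append : ∀ T x U, motive T → motive U → motive (append T x U)) : motive T :=
  T.rec (motive_2 := fun b => motive (last b)) (fun _ h => h) (fun b => append (last b)) dot graft

theorem lastBranch_append (T : AngTree X) (x : X) (U : AngTree X) :
    (append T x U).lastBranch = U.lastBranch :=
  match T with
  | last _ => rfl
  | cons _ _ T => lastBranch_append T x U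

theorem firstBranch_append (T : AngTree X) (x : X) (U : AngTree X) :
    (append T x U).firstBranch = T.firstBranch := by
  cases T <;> rfl

theorem setFirst_append (b : AngBranch X) (T : AngTree X) (x : X) (U : AngTree X) :
    (append T x U).setFirst b = append (T.setFirst b) x U := by
  cases T <;> rfl

theorem join_append_left (T : AngTree X) (x : X) (U : AngTree X) (b : AngBranch X)
    (V : AngTree X) : join (append T x U) b V = append T x (join U b V) :=
  match T with
  | last _ => rfl
  | cons c y T => congrArg (cons c y) (join_append_left T x U b V)

theorem join_append_right (T : AngTree X) (b : AngBranch X) (U : AngTree X) (x : X)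
    (V : AngTree X) : join T b (append U x V) = append (join T b U) x V :=
  match T with
  | last _ => setFirst_append b U x V
  | cons c y T => congrArg (cons c y) (join_append_right T b U x V)

theorem setFirst_firstBranch (T : AngTree X) : T.setFirst T.firstBranch = T := by
  cases T <;> rfl

theorem join_lastBranch_dot (T : AngTree X) : join T T.lastBranch dot = T :=
  match T with
  | last _ => rfl
  | cons c y T => congrArg (cons c y) (join_lastBranch_dot T)

end Append

section Diamond

variable {k X : Type*} [CommRing k] (lam : k)

/-- The combination of branches `b` in the product `T ⋄ T' = ∑ c_b [T₁, x₁, …, xₘ, b, y₁, T'₂, …]`;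
it depends only on the rightmost branch of `T` and the leftmost branch of `T'`. -/
noncomputable def branchMul : AngBranch X → AngBranch X → AngBranch X →₀ k
  | .leaf, b => Finsupp.single b 1
  | .edge S, .leaf => Finsupp.single (.edge S) 1
  | .edge S, .edge S' => Finsupp.mapDomain .edge
      (diamond lam S.graft S' + diamond lam S S'.graft + lam • diamond lam S S')

theorem branchMul_leaf_right (b : AngBranch X) :
    branchMul lam b .leaf = Finsupp.single b 1 := by
  cases b <;> rfl

theorem diamond_eq_mapDomain_branchMul (T T' : AngTree X) :
    diamond lam T T' = Finsupp.mapDomain (fun b => join T b T')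
      (branchMul lam T.lastBranch T'.firstBranch) := by
  rw [diamond]
  split
  case h_1 h => rw [h, branchMul, Finsupp.mapDomain_single]
  case h_2 h h' => rw [h, h', branchMul, Finsupp.mapDomain_single]
  case h_3 h h' => rw [h, h', branchMul, ← Finsupp.mapDomain_comp, Function.comp_def]

theorem diamond_append_left (T : AngTree X) (x : X) (U V : AngTree X) :
    diamond lam (append T x U) V = Finsupp.mapDomain (append T x) (diamond lam U V) := by
  simp only [diamond_eq_mapDomain_branchMul, ← Finsupp.mapDomain_comp, Function.comp_def,
    lastBranch_append, join_append_left]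

theorem diamond_append_right (T U : AngTree X) (x : X) (V : AngTree X) :
    diamond lam T (append U x V) =
      Finsupp.mapDomain (fun W => append W x V) (diamond lam T U) := by
  simp only [diamond_eq_mapDomain_branchMul, ← Finsupp.mapDomain_comp, Function.comp_def,
    firstBranch_append, join_append_right]

theorem diamond_dot_left (T : AngTree X) : diamond lam dot T = Finsupp.single T 1 := by
  rw [diamond_eq_mapDomain_branchMul, dot, lastBranch, branchMul, Finsupp.mapDomain_single, join,
    setFirst_firstBranch]

theorem diamond_dot_right (T : AngTree X) : diamond lam T dot = Finsupp.single T 1 := by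
  rw [diamond_eq_mapDomain_branchMul, dot, firstBranch, branchMul_leaf_right,
    Finsupp.mapDomain_single, ← dot, join_lastBranch_dot]

theorem diamond_graft_graft (S S' : AngTree X) :
    diamond lam S.graft S'.graft = Finsupp.mapDomain graft
      (diamond lam S.graft S' + diamond lam S S'.graft + lam • diamond lam S S') := by
  rw [diamond_eq_mapDomain_branchMul, graft, graft, lastBranch, firstBranch, branchMul,
    ← Finsupp.mapDomain_comp]
  rfl

end Diamond

section FreeModule

variable {k X : Type*} [CommRing k] (lam : k)

/-- The bilinear extension of `append` to `k 𝒯(X)`. -/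
noncomputable def appendHom (k : Type*) [CommRing k] {X : Type*} (x : X) :
    (AngTree X →₀ k) →ₗ[k] (AngTree X →₀ k) →ₗ[k] (AngTree X →₀ k) :=
  Finsupp.linearCombination k fun T : AngTree X => Finsupp.lmapDomain k k (append T x)

theorem mulHom_single (T T' : AngTree X) :
    mulHom X lam (Finsupp.single T 1) (Finsupp.single T' 1) = diamond lam T T' := by
  simp [mulHom]

theorem graftHom_single (T : AngTree X) :
    graftHom k X (Finsupp.single T 1) = Finsupp.single T.graft 1 := by
  simp [graftHom]

theorem appendHom_single_left (x : X) (T : AngTree X) (a : AngTree X →₀ k) :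
    appendHom k x (Finsupp.single T 1) a = Finsupp.mapDomain (append T x) a := by
  simp [appendHom]

theorem appendHom_single (x : X) (T U : AngTree X) :
    appendHom k x (Finsupp.single T 1) (Finsupp.single U 1) =
      Finsupp.single (append T x U) 1 := by
  rw [appendHom_single_left, Finsupp.mapDomain_single]

theorem appendHom_single_right (x : X) (a : AngTree X →₀ k) (U : AngTree X) :
    appendHom k x a (Finsupp.single U 1) = Finsupp.mapDomain (fun T => append T x U) a := by
  have h : (appendHom k x).flip (Finsupp.single U 1) =
      Finsupp.lmapDomain k k (fun T => append T x U) := by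
    ext T : 2
    simp [appendHom_single]
  exact LinearMap.congr_fun h a

theorem linearMap_ext_of_unit_graft_append {M : Type*} [AddCommMonoid M] [Module k M]
    {F G : (AngTree X →₀ k) →ₗ[k] M} (unit : F (unit k X) = G (unit k X))
    (graft : ∀ a, F a = G a → F (graftHom k X a) = G (graftHom k X a))
    (append : ∀ x a b, F a = G a → F b = G b → F (appendHom k x a b) = G (appendHom k x a b)) :
    F = G := by
  refine Finsupp.lhom_ext' fun T => LinearMap.ext_ring ?_
  simp only [LinearMap.comp_apply, Finsupp.lsingle_apply]
  induction T using dot_graft_append_induction with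
  | dot => exact unit
  | graft T hT => simpa only [graftHom_single] using graft _ hT
  | append T x U hT hU => simpa only [appendHom_single] using append x _ _ hT hU

theorem mulHom_unit_left (a : AngTree X →₀ k) : mulHom X lam (unit k X) a = a := by
  have h : mulHom X lam (unit k X) = LinearMap.id := by
    ext T : 2
    simp [unit, mulHom_single, diamond_dot_left]
  exact LinearMap.congr_fun h a

theorem mulHom_unit_right (a : AngTree X →₀ k) : mulHom X lam a (unit k X) = a := by
  have h : (mulHom X lam).flip (unit k X) = LinearMap.id := by
    ext T : 2
    simp [unit, mulHom_single, diamond_dot_right]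
  exact LinearMap.congr_fun h a

theorem mulHom_appendHom_left (x : X) (a b c : AngTree X →₀ k) :
    mulHom X lam (appendHom k x a b) c = appendHom k x a (mulHom X lam b c) := by
  refine mixedAssociator_eq_zero_iff.mp ?_ a b c
  ext T U V : 6
  simp [mixedAssociator_apply, mulHom_single, diamond_append_left, appendHom_single_left]

theorem mulHom_appendHom_right (x : X) (a b c : AngTree X →₀ k) :
    mulHom X lam a (appendHom k x b c) = appendHom k x (mulHom X lam a b) c := by
  refine (mixedAssociator_eq_zero_iff.mp ?_ a b c).symm
  ext T U V : 6
  simp [mixedAssociator_apply, mulHom_single, diamond_append_right, appendHom_single_right]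

theorem mulHom_mulHom_gen (x : X) (a b : AngTree X →₀ k) :
    mulHom X lam (mulHom X lam a (gen k x)) b = appendHom k x a b := by
  have gen_eq : gen k x = appendHom k x (unit k X) (unit k X) :=
    (appendHom_single x dot dot).symm
  rw [gen_eq, mulHom_appendHom_right, mulHom_appendHom_left, mulHom_unit_right, mulHom_unit_left]

theorem isRotaBaxterOperator_graftHom :
    IsRotaBaxterOperator lam (mulHom X lam) (graftHom k X) := by
  have h : (mulHom X lam).compl₁₂ (graftHom k X) (graftHom k X) =
      (mulHom X lam ∘ₗ graftHom k X + (mulHom X lam).compl₂ (graftHom k X) +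
        lam • mulHom X lam).compr₂ (graftHom k X) := by
    ext T T' : 4
    simp [mulHom_single, diamond_graft_graft, graftHom]
  exact fun a b => LinearMap.congr_fun₂ h a b

end FreeModule

section Associativity

variable {k X : Type*} [CommRing k] (lam : k)

theorem mulAssociator_unit_left (b c : AngTree X →₀ k) :
    mulAssociator (mulHom X lam) (unit k X) b c = 0 := by
  rw [mulAssociator_apply, mulHom_unit_left, mulHom_unit_left, sub_self]

theorem mulAssociator_unit_middle (a c : AngTree X →₀ k) :
    mulAssociator (mulHom X lam) a (unit k X) c = 0 := by
  rw [mulAssociator_apply, mulHom_unit_right, mulHom_unit_left, sub_self]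

theorem mulAssociator_unit_right (a b : AngTree X →₀ k) :
    mulAssociator (mulHom X lam) a b (unit k X) = 0 := by
  rw [mulAssociator_apply, mulHom_unit_right, mulHom_unit_right, sub_self]

theorem mulAssociator_appendHom_left (x : X) (a b c d : AngTree X →₀ k) :
    mulAssociator (mulHom X lam) (appendHom k x a b) c d =
      appendHom k x a (mulAssociator (mulHom X lam) b c d) := by
  simp only [mulAssociator_apply, mulHom_appendHom_left, map_sub]

theorem mulAssociator_appendHom_middle (x : X) (a b c d : AngTree X →₀ k) :
    mulAssociator (mulHom X lam) a (appendHom k x b c) d = 0 := by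
  simp only [mulAssociator_apply, mulHom_appendHom_right, mulHom_appendHom_left, sub_self]

theorem mulAssociator_appendHom_right (x : X) (a b c d : AngTree X →₀ k) :
    mulAssociator (mulHom X lam) a b (appendHom k x c d) =
      appendHom k x (mulAssociator (mulHom X lam) a b c) d := by
  simp only [mulAssociator_apply, mulHom_appendHom_right, map_sub, LinearMap.sub_apply]

theorem mulAssociator_graftHom_graftHom_graftHom {a b : AngTree X →₀ k}
    (ha : mulAssociator (mulHom X lam) a = 0)
    (hb : mulAssociator (mulHom X lam) (graftHom k X a) b = 0) {c : AngTree X →₀ k}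
    (hc : mulAssociator (mulHom X lam) (graftHom k X a) (graftHom k X b) c = 0) :
    mulAssociator (mulHom X lam) (graftHom k X a) (graftHom k X b) (graftHom k X c) = 0 := by
  rw [(isRotaBaxterOperator_graftHom lam).mulAssociator_map]
  simp only [ha, hb, hc, LinearMap.zero_apply, add_zero, smul_zero, map_zero]

theorem mulAssociator_graftHom_graftHom {a b : AngTree X →₀ k}
    (ha : mulAssociator (mulHom X lam) a = 0)
    (hb : mulAssociator (mulHom X lam) (graftHom k X a) b = 0) :
    mulAssociator (mulHom X lam) (graftHom k X a) (graftHom k X b) = 0 := by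
  refine linearMap_ext_of_unit_graft_append ?unit (fun c hc => ?graft) fun x c₁ c₂ hc₁ _ => ?append
  case unit => exact mulAssociator_unit_right lam _ _
  case graft => exact mulAssociator_graftHom_graftHom_graftHom lam ha hb hc
  case append => simp only [mulAssociator_appendHom_right, hc₁, LinearMap.zero_apply, map_zero]

theorem mulAssociator_graftHom {a : AngTree X →₀ k} (ha : mulAssociator (mulHom X lam) a = 0) :
    mulAssociator (mulHom X lam) (graftHom k X a) = 0 := by
  refine linearMap_ext_of_unit_graft_append ?unit (fun b hb => ?graft) fun x b₁ b₂ _ _ => ?append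
  case unit => exact LinearMap.ext (mulAssociator_unit_middle lam _)
  case graft => exact mulAssociator_graftHom_graftHom lam ha hb
  case append => exact LinearMap.ext (mulAssociator_appendHom_middle lam x _ b₁ b₂)

theorem mulAssociator_mulHom : mulAssociator (mulHom X lam) = 0 := by
  refine linearMap_ext_of_unit_graft_append ?unit (fun a ha => ?graft) fun x a₁ a₂ _ ha₂ => ?append
  case unit => exact LinearMap.ext₂ (mulAssociator_unit_left lam)
  case graft => exact mulAssociator_graftHom lam ha
  case append =>
    refine LinearMap.ext₂ fun b c => ?_
    simp only [mulAssociator_appendHom_left, ha₂, LinearMap.zero_apply, map_zero]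

theorem mulHom_assoc (a b c : AngTree X →₀ k) :
    mulHom X lam (mulHom X lam a b) c = mulHom X lam a (mulHom X lam b c) :=
  mixedAssociator_eq_zero_iff.mp (mulAssociator_mulHom lam) a b c

end Associativity

section Eval

variable {X R : Type*} [Monoid R] (Q : R → R) (f : X → R)

mutual

/-- The value of a tree in a monoid, where `Q` stands for grafting and `f` evaluates the angle
decorations: `[T₁, x₁, …, xₙ, Tₙ₊₁]` has the value `v₁ * f x₁ * ⋯ * f xₙ * vₙ₊₁`, where `vᵢ` is the
value of the branch `Tᵢ`. -/
def eval : AngTree X → R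
  | last b => evalBranch b
  | cons b x T => evalBranch b * f x * eval T

/-- The value of a branch for `AngTree.eval`: a leaf is evaluated to `1`, and an edge applies `Q`
to the value of the tree that it carries. -/
def evalBranch : AngBranch X → R
  | .leaf => 1
  | .edge T => Q (eval T)

end

theorem eval_append (T : AngTree X) (x : X) (U : AngTree X) :
    eval Q f (append T x U) = eval Q f T * f x * eval Q f U :=
  match T with
  | last _ => by rw [append, eval, eval]
  | cons _ _ T => by simp only [append, eval, eval_append T x U, mul_assoc]

end Eval

section Lift

variable {k X R : Type*} [CommRing k] [Ring R] [Algebra k R]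

/-- The linear extension of `AngTree.eval` to `k 𝒯(X)`: for a Rota–Baxter operator `Q` it is the
homomorphism given by the universal property. -/
noncomputable def lift (Q : R →ₗ[k] R) (f : X → R) : (AngTree X →₀ k) →ₗ[k] R :=
  Finsupp.linearCombination k (eval Q f)

variable (Q : R →ₗ[k] R) (f : X → R)

theorem lift_single (T : AngTree X) : lift Q f (Finsupp.single T 1) = eval Q f T := by
  simp [lift]

theorem lift_unit : lift Q f (unit k X) = 1 := by
  rw [unit, lift_single, dot, eval, evalBranch]

theorem lift_gen (x : X) : lift Q f (gen k x) = f x := by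
  simp [gen, lift_single, corolla, eval, evalBranch]

theorem lift_graftHom (a : AngTree X →₀ k) : lift Q f (graftHom k X a) = Q (lift Q f a) := by
  have h : lift Q f ∘ₗ graftHom k X = Q ∘ₗ lift Q f := by
    ext T : 2
    simp [graftHom_single, lift_single, graft, eval, evalBranch]
  exact LinearMap.congr_fun h a

theorem lift_appendHom (x : X) (a b : AngTree X →₀ k) :
    lift Q f (appendHom k x a b) = lift Q f a * f x * lift Q f b := by
  have h : (appendHom k x).compr₂ (lift Q f) =
      (LinearMap.mul k R).compl₁₂ (LinearMap.mulRight k (f x) ∘ₗ lift Q f) (lift Q f) := by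
    ext T U : 4
    simp [appendHom_single, lift_single, eval_append]
  exact LinearMap.congr_fun₂ h a b

variable {lam : k} {Q} {f}

theorem lift_mulHom_graftHom_graftHom (hQ : IsRotaBaxterOperator lam (LinearMap.mul k R) Q)
    {a b : AngTree X →₀ k}
    (h_left : lift Q f (mulHom X lam (graftHom k X a) b) = lift Q f (graftHom k X a) * lift Q f b)
    (h_right : lift Q f (mulHom X lam a (graftHom k X b)) = lift Q f a * lift Q f (graftHom k X b))
    (h : lift Q f (mulHom X lam a b) = lift Q f a * lift Q f b) :
    lift Q f (mulHom X lam (graftHom k X a) (graftHom k X b)) =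
      lift Q f (graftHom k X a) * lift Q f (graftHom k X b) := by
  rw [isRotaBaxterOperator_graftHom lam a b, lift_graftHom, map_add (lift Q f), map_add (lift Q f),
    map_smul (lift Q f), h_left, h_right, h, lift_graftHom, lift_graftHom]
  exact (hQ _ _).symm

theorem lift_mulHom_graftHom_left (hQ : IsRotaBaxterOperator lam (LinearMap.mul k R) Q)
    {a : AngTree X →₀ k} (ha : ∀ b, lift Q f (mulHom X lam a b) = lift Q f a * lift Q f b)
    (b : AngTree X →₀ k) :
    lift Q f (mulHom X lam (graftHom k X a) b) = lift Q f (graftHom k X a) * lift Q f b := by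
  have h : lift Q f ∘ₗ mulHom X lam (graftHom k X a) =
      LinearMap.mulLeft k (lift Q f (graftHom k X a)) ∘ₗ lift Q f := by
    refine linearMap_ext_of_unit_graft_append ?unit (fun b hb => ?graft) fun x b c hb _ => ?append
    case graft => exact lift_mulHom_graftHom_graftHom hQ hb (ha _) (ha b)
    all_goals simp only [LinearMap.comp_apply, LinearMap.mulLeft_apply] at *
    case unit => rw [mulHom_unit_right, lift_unit, mul_one]
    case append => simp only [mulHom_appendHom_right, lift_appendHom, hb, mul_assoc]
  exact LinearMap.congr_fun h b

theorem lift_mulHom_appendHom_left (x : X) (a : AngTree X →₀ k) {b c : AngTree X →₀ k}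
    (hb : lift Q f (mulHom X lam b c) = lift Q f b * lift Q f c) :
    lift Q f (mulHom X lam (appendHom k x a b) c) =
      lift Q f (appendHom k x a b) * lift Q f c := by
  rw [mulHom_appendHom_left, lift_appendHom, lift_appendHom, hb, mul_assoc _ _ (lift Q f c)]

variable (f)

theorem lift_mulHom (hQ : IsRotaBaxterOperator lam (LinearMap.mul k R) Q)
    (a b : AngTree X →₀ k) : lift Q f (mulHom X lam a b) = lift Q f a * lift Q f b := by
  have h : (mulHom X lam).compr₂ (lift Q f) =
      (LinearMap.mul k R).compl₁₂ (lift Q f) (lift Q f) := by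
    refine linearMap_ext_of_unit_graft_append ?unit (fun a ha => ?graft) fun x a b _ hb => ?append
    case unit =>
      refine LinearMap.ext fun b => ?_
      simp only [LinearMap.compr₂_apply, LinearMap.compl₁₂_apply, LinearMap.mul_apply',
        mulHom_unit_left, lift_unit, one_mul]
    case graft => exact LinearMap.ext (lift_mulHom_graftHom_left hQ (LinearMap.congr_fun ha))
    case append =>
      exact LinearMap.ext fun c => lift_mulHom_appendHom_left x a (LinearMap.congr_fun hb c)
  exact LinearMap.congr_fun₂ h a b

variable {f}

theorem eq_lift {φ : (AngTree X →₀ k) →ₗ[k] R} (map_unit : φ (unit k X) = 1)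
    (map_mul : ∀ a b, φ (mulHom X lam a b) = φ a * φ b)
    (map_graft : ∀ a, φ (graftHom k X a) = Q (φ a)) (map_gen : ∀ x, φ (gen k x) = f x) :
    φ = lift Q f := by
  refine linearMap_ext_of_unit_graft_append ?unit (fun a ha => ?graft) fun x a b ha hb => ?append
  case unit => rw [map_unit, lift_unit]
  case graft => rw [map_graft, lift_graftHom, ha]
  case append =>
    rw [← mulHom_mulHom_gen lam, map_mul, map_mul, map_gen, mulHom_mulHom_gen,
      lift_appendHom, ha, hb]

end Lift

end AngTree

theorem mainTheorem2 {k : Type u} [CommRing k] (X : Type v) (lam : k) :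
    IsFreeRotaBaxterAlgebra.{u, v, w} lam (AngTree.mulHom X lam) (AngTree.unit k X)
      (AngTree.graftHom k X) (AngTree.gen k : X → (AngTree X →₀ k)) where
  mul_assoc := AngTree.mulHom_assoc lam
  one_mul := AngTree.mulHom_unit_left lam
  mul_one := AngTree.mulHom_unit_right lam
  rotaBaxter := AngTree.isRotaBaxterOperator_graftHom lam
  existsUnique_hom R _ _ Q hQ f := by
    refine ⟨AngTree.lift Q f, ⟨AngTree.lift_unit Q f, AngTree.lift_mulHom f hQ,
      AngTree.lift_graftHom Q f, AngTree.lift_gen Q f⟩, ?_⟩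
    rintro φ ⟨map_unit, map_mul, map_graft, map_gen⟩
    exact AngTree.eq_lift map_unit map_mul map_graft map_gen
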